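/- Let $\mathbb{R}^{0,2,1}$ denote $\mathbb{R}^3$ with its canonical coordinates $(x,y,z)$ and the degenerate metric $dx^2+dy^2$. Let $(M,g)$ be a connected, two-dimensional, complete smooth Riemannian manifold (without boundary), and let $f:(M,g)\to\mathbb{R}^{0,2,1}$ be an isometric immersion, i.e. a $C^\infty$ immersion $f:M\to\mathbb{R}^3$ with $f^*(dx^2+dy^2)=g$. Then: (i) $(M,g)$ is isometric to the Euclidean plane $\mathbb{R}^2$, i.e. there is a $C^\infty$ diffeomorphism $\Phi:M\to\mathbb{R}^2$ with $\Phi^*(du^2+dv^2)=g$; and (ii) there is a $C^\infty$ function $F:\mathbb{R}^2\to\mathbb{R}$, defined on all of $\mathbb{R}^2$, such that the image of $f$ is the entire graph $$f(M)=\{(u,v,F(u,v)) : (u,v)\in\mathbb{R}^2\}.$$ -/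

import Mathlib

open Bundle
open scoped Manifold ContDiff

noncomputable section

namespace SingularSemiEuclidean

-- Makes instance search use the identity chart on the vector spaces `ℝ²` and `ℝ³` directly.
attribute [local instance 2000] chartedSpaceSelf

/-- The smooth manifold `ℝ³` underlying the singular semi-Euclidean space `ℝ^{0,2,1}`, with
canonical coordinates `(x, y, z) = (p 0, p 1, p 2)`. The Euclidean norm of this type only provides
the standard smooth structure; the metric of `ℝ^{0,2,1}` is `degenerateMetric`. -/
abbrev R021 : Type := EuclideanSpace ℝ (Fin 3)

/-- The degenerate metric `dx² + dy²` of `ℝ^{0,2,1}`, on each tangent space `T_p ℝ³`. -/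
def degenerateMetric (p : R021) (v w : TangentSpace (𝓡 3) p) : ℝ :=
  letI V : R021 := v
  letI W : R021 := w
  V 0 * W 0 + V 1 * W 1

section

variable {M : Type*} [TopologicalSpace M] [ChartedSpace (EuclideanSpace ℝ (Fin 2)) M]
  [IsManifold (𝓡 2) ∞ M] [RiemannianBundle (fun x : M ↦ TangentSpace (𝓡 2) x)]

/-- `f : (M, g) → ℝ^{0,2,1}` is an isometric immersion of the Riemannian surface `(M, g)`: a `C^∞`
map with injective differentials which pulls the degenerate metric `dx² + dy²` back to `g`. -/
structure IsIsometricImmersion (f : M → R021) : Prop where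
  contMDiff : ContMDiff (𝓡 2) (𝓡 3) ∞ f
  injective_mfderiv : ∀ x : M, Function.Injective (mfderiv (𝓡 2) (𝓡 3) f x)
  pullback_eq : ∀ (x : M) (v w : TangentSpace (𝓡 2) x),
    degenerateMetric (f x) (mfderiv (𝓡 2) (𝓡 3) f x v) (mfderiv (𝓡 2) (𝓡 3) f x w) = inner ℝ v w

variable (M) in
/-- `(M, g)` is isometric to the Euclidean plane `ℝ²`: there is a `C^∞` diffeomorphism `M → ℝ²`
which pulls the Euclidean metric of `ℝ²` back to `g`. -/
def IsIsometricToEuclideanPlane : Prop :=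
  ∃ Φ : M ≃ₘ^∞⟮𝓡 2, 𝓡 2⟯ EuclideanSpace ℝ (Fin 2),
    ∀ (x : M) (v w : TangentSpace (𝓡 2) x),
      inner ℝ (mfderiv (𝓡 2) (𝓡 2) Φ x v) (mfderiv (𝓡 2) (𝓡 2) Φ x w) = inner ℝ v w

end

/-- The entire graph `{(u, v, F(u, v)) | (u, v) ∈ ℝ²}` in `ℝ^{0,2,1}`. -/
def entireGraph (F : EuclideanSpace ℝ (Fin 2) → ℝ) : Set R021 :=
  {p | ∃ u v : ℝ, p = !₂[u, v, F !₂[u, v]]}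

end SingularSemiEuclidean

end

/-! Composing `f` with the projection `(x, y, z) ↦ (x, y)` gives a local isometry `p` from the
complete surface `M` to the Euclidean plane. A lift of a segment through `p` has the length of the
part of the segment it covers, so it is Lipschitz and, by completeness, has a limit at the end of
its interval of definition; hence all segments lift. The end points of the lifts of the segments
issuing from `p x` form a continuous section of `p`, which by uniqueness of lifts inverts `p`. So
`p` is an isometry onto the plane, and the image of `f` is the graph of the third coordinate of
`f ∘ p⁻¹`. -/

namespace LocalIsometry

open Set Filter Topology Manifold MeasureTheory
open scoped NNReal ENNReal

section Lifting

variable {A X Y : Type*} [TopologicalSpace A] [TopologicalSpace X]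

/-- `γ` is a continuous lift of `c` through `p` over the set `s`. Nothing is asked of `γ` outside
`s`, so that curves on intervals are functions on the whole line. -/
structure IsLiftOn (p : X → Y) (c : A → Y) (s : Set A) (γ : A → X) : Prop where
  continuousOn : ContinuousOn γ s
  eqOn : EqOn (p ∘ γ) c s

namespace IsLiftOn

variable {p : X → Y} {c : A → Y} {s t : Set A} {γ γ' : A → X}

theorem mono (hγ : IsLiftOn p c t γ) (hst : s ⊆ t) : IsLiftOn p c s γ :=
  ⟨hγ.continuousOn.mono hst, hγ.eqOn.mono hst⟩

theorem congr (hγ : IsLiftOn p c s γ) (h : EqOn γ' γ s) : IsLiftOn p c s γ' :=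
  ⟨hγ.continuousOn.congr h, fun _ ha ↦ (congrArg p (h ha)).trans (hγ.eqOn ha)⟩

theorem union_of_isClosed (hs : IsLiftOn p c s γ) (ht : IsLiftOn p c t γ) (hsc : IsClosed s)
    (htc : IsClosed t) : IsLiftOn p c (s ∪ t) γ :=
  ⟨hs.continuousOn.union_of_isClosed ht.continuousOn hsc htc, hs.eqOn.union ht.eqOn⟩

theorem eqOn_of_isPreconnected (hγ : IsLiftOn p c s γ) (hγ' : IsLiftOn p c s γ')
    (hsep : IsSeparatedMap p) (hinj : IsLocallyInjective p) (hs : IsPreconnected s) {a : A}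
    (ha : a ∈ s) (h : γ a = γ' a) : EqOn γ γ' s :=
  hsep.eqOn_of_comp_eqOn hinj hs hγ.continuousOn hγ'.continuousOn (hγ.eqOn.trans hγ'.eqOn.symm)
    ha h

end IsLiftOn

section Real

variable {p : X → Y} {c : ℝ → Y} {γ γ' : ℝ → X} {a b d : ℝ}

theorem IsLiftOn.exists_append (hγ : IsLiftOn p c (Icc a b) γ) (hγ' : IsLiftOn p c (Icc b d) γ')
    (h : γ b = γ' b) (hab : a ≤ b) (hbd : b ≤ d) :
    ∃ Γ, IsLiftOn p c (Icc a d) Γ ∧ Γ a = γ a := by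
  let Γ : ℝ → X := (Iic b).piecewise γ γ'
  have hleft : EqOn Γ γ (Icc a b) := fun _ ht ↦ piecewise_eq_of_mem _ _ _ ht.2
  have hright : EqOn Γ γ' (Icc b d) := by
    intro t ht
    rcases ht.1.eq_or_lt with rfl | hbt
    · exact (hleft (right_mem_Icc.2 hab)).trans h
    · exact piecewise_eq_of_notMem _ _ _ (notMem_Iic.2 hbt)
  refine ⟨Γ, ?_, hleft (left_mem_Icc.2 hab)⟩
  rw [← Icc_union_Icc_eq_Icc hab hbd]
  exact (hγ.congr hleft).union_of_isClosed (hγ'.congr hright) isClosed_Icc isClosed_Icc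

theorem exists_isLiftOn_Ico (hsep : IsSeparatedMap p) (hinj : IsLocallyInjective p) {x : X}
    (hab : a < b) (h : ∀ t ∈ Ico a b, ∃ γ, IsLiftOn p c (Icc a t) γ ∧ γ a = x) :
    ∃ γ, IsLiftOn p c (Ico a b) γ ∧ γ a = x := by
  have : Nonempty X := ⟨x⟩
  choose! γ hγ hγa using h
  let Γ : ℝ → X := fun t ↦ γ t t
  have hagree : ∀ s ∈ Ico a b, EqOn Γ (γ s) (Icc a s) := by
    intro s hs t ht
    have htb : t ∈ Ico a b := ⟨ht.1, ht.2.trans_lt hs.2⟩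
    exact (hγ t htb).eqOn_of_isPreconnected ((hγ s hs).mono (Icc_subset_Icc_right ht.2)) hsep hinj
      isPreconnected_Icc (left_mem_Icc.2 ht.1) ((hγa t htb).trans (hγa s hs).symm)
      (right_mem_Icc.2 ht.1)
  have hΓ : ∀ s ∈ Ico a b, IsLiftOn p c (Icc a s) Γ := fun s hs ↦ (hγ s hs).congr (hagree s hs)
  refine ⟨Γ, ⟨fun t ht ↦ ?_, fun t ht ↦ (hΓ t ht).eqOn (right_mem_Icc.2 ht.1)⟩,
    hγa a (left_mem_Ico.2 hab)⟩
  obtain ⟨s, hts, hsb⟩ := exists_between ht.2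
  refine ((hΓ s ⟨ht.1.trans hts.le, hsb⟩).continuousOn t ⟨ht.1, hts.le⟩).mono_of_mem_nhdsWithin ?_
  filter_upwards [self_mem_nhdsWithin, mem_nhdsWithin_of_mem_nhds (Iio_mem_nhds hts)]
    with u hu hus using ⟨hu.1, hus.le⟩

variable [TopologicalSpace Y]

theorem IsLiftOn.exists_extension (hγ : IsLiftOn p c (Icc a b) γ) (hp : IsLocalHomeomorph p)
    (hc : Continuous c) (hab : a ≤ b) (hbd : b < d) :
    ∃ b' ∈ Ioc b d, ∃ Γ, IsLiftOn p c (Icc a b') Γ ∧ Γ a = γ a := by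
  obtain ⟨e, hbe, rfl⟩ := hp (γ b)
  have hcb : e (γ b) = c b := hγ.eqOn (right_mem_Icc.2 hab)
  have htarget : ∀ᶠ t in 𝓝 b, c t ∈ e.target :=
    hc.continuousAt.eventually_mem (e.open_target.mem_nhds (hcb ▸ e.map_source hbe))
  obtain ⟨b', hbb', hsub⟩ := mem_nhdsGE_iff_exists_Icc_subset.1 <|
    nhdsWithin_le_nhds (htarget.and (Iic_mem_nhds hbd))
  have hlift : IsLiftOn e c (Icc b b') (e.symm ∘ c) :=
    ⟨e.continuousOn_symm.comp hc.continuousOn fun t ht ↦ (hsub ht).1,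
      fun t ht ↦ e.right_inv (hsub ht).1⟩
  have hglue : γ b = (e.symm ∘ c) b := by
    rw [Function.comp_apply, ← hcb, e.left_inv hbe]
  exact ⟨b', ⟨hbb', (hsub (right_mem_Icc.2 hbb'.le)).2⟩,
    hγ.exists_append hlift hglue hab hbb'.le⟩

theorem IsLiftOn.update_right [T2Space Y] (hγ : IsLiftOn p c (Ico a b) γ) (hp : Continuous p)
    (hc : Continuous c) (hab : a < b) {x : X} (hx : Tendsto γ (𝓝[<] b) (𝓝 x)) :
    IsLiftOn p c (Icc a b) (Function.update γ b x) := by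
  have hpx : p x = c b := by
    refine tendsto_nhds_unique ((hp.tendsto x).comp hx) ?_
    refine (hc.continuousWithinAt (s := Iio b)).tendsto.congr' ?_
    filter_upwards [Ico_mem_nhdsLT hab] with t ht using (hγ.eqOn ht).symm
  refine ⟨continuousOn_update_iff.2 ⟨?_, fun _ ↦ ?_⟩, fun t ht ↦ ?_⟩
  · simpa only [Icc_sdiff_right] using hγ.continuousOn
  · exact hx.mono_left (nhdsWithin_mono b fun t ht ↦ ht.1.2.lt_of_ne ht.2)
  · rcases ht.2.eq_or_lt with rfl | htb
    · simpa using hpx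
    · simpa [htb.ne] using hγ.eqOn ⟨ht.1, htb⟩

theorem exists_isLiftOn_Icc_of_tendsto [T2Space X] [T2Space Y] (hp : IsLocalHomeomorph p)
    (hc : Continuous c) (hab : a ≤ b) {x : X} (hx : p x = c a)
    (hlim : ∀ t > a, ∀ γ, IsLiftOn p c (Ico a t) γ → ∃ y, Tendsto γ (𝓝[<] t) (𝓝 y)) :
    ∃ γ, IsLiftOn p c (Icc a b) γ ∧ γ a = x := by
  let S : Set ℝ := {t | ∃ γ, IsLiftOn p c (Icc a t) γ ∧ γ a = x}
  have hSa : a ∈ S := ⟨fun _ ↦ x, ⟨continuousOn_const, by simp [hx]⟩, rfl⟩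
  have hanti : ∀ s t, s ≤ t → t ∈ S → s ∈ S := fun s t hst ⟨γ, hγ, hγa⟩ ↦
    ⟨γ, hγ.mono (Icc_subset_Icc_right hst), hγa⟩
  have hlimit : ∀ t > a, (∀ s ∈ Ico a t, s ∈ S) → t ∈ S := by
    intro t hat ht
    obtain ⟨γ, hγ, hγa⟩ :=
      exists_isLiftOn_Ico (T2Space.isSeparatedMap p) hp.isLocallyInjective hat ht
    obtain ⟨y, hy⟩ := hlim t hat γ hγ
    exact ⟨_, hγ.update_right hp.continuous hc hat hy, by simpa [hat.ne] using hγa⟩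
  have hclosed : IsClosed (S ∩ Icc a b) := by
    refine isClosed_of_closure_subset fun t ht ↦ ?_
    have htab : t ∈ Icc a b := closure_minimal inter_subset_right isClosed_Icc ht
    refine ⟨?_, htab⟩
    rcases htab.1.eq_or_lt with rfl | hat
    · exact hSa
    · refine hlimit t hat fun s hs ↦ ?_
      obtain ⟨u, hsu, huS, -⟩ := mem_closure_iff.1 ht (Ioi s) isOpen_Ioi hs.2
      exact hanti s u hsu.le huS
  refine hclosed.Icc_subset_of_forall_exists_gt hSa ?_ (right_mem_Icc.2 hab)
  rintro t ⟨⟨γ, hγ, hγa⟩, hta, -⟩ d hd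
  obtain ⟨t', ht', Γ, hΓ, hΓa⟩ := hγ.exists_extension hp hc hta hd
  exact ⟨t', ⟨Γ, hΓ, hΓa.trans hγa⟩, ht'⟩

end Real

section Segments

variable {V : Type*} [AddCommGroup V] [Module ℝ V] [TopologicalSpace V] [IsTopologicalAddGroup V]
  [ContinuousSMul ℝ V] {p : X → V}

theorem exists_continuous_rightInverse_of_lift_segments [T2Space X] (hp : IsLocalHomeomorph p)
    {x : X} (hlift : ∀ y, ∃ γ, IsLiftOn p (AffineMap.lineMap (p x) y) (Icc (0 : ℝ) 1) γ ∧ γ 0 = x) :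
    ∃ σ : V → X, Continuous σ ∧ Function.RightInverse σ p ∧ σ (p x) = x := by
  choose γ hγ hγ0 using hlift
  have h0 : (0 : ℝ) ∈ Icc (0 : ℝ) 1 := left_mem_Icc.2 zero_le_one
  have h1 : (1 : ℝ) ∈ Icc (0 : ℝ) 1 := right_mem_Icc.2 zero_le_one
  have hcont : Continuous fun ty : unitInterval × V ↦ γ ty.2 ty.1 := by
    refine hp.continuous_lift (T2Space.isSeparatedMap p)
      ⟨fun ty ↦ AffineMap.lineMap (p x) ty.2 (ty.1 : ℝ),
        continuous_const.lineMap continuous_snd (by fun_prop)⟩ ?_ ?_ ?_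
    · exact funext fun ty ↦ (hγ ty.2).eqOn ty.1.2
    · exact continuous_const.congr fun y ↦ (hγ0 y).symm
    · exact fun y ↦ (hγ y).continuousOn.comp_continuous continuous_subtype_val Subtype.prop
  refine ⟨fun y ↦ γ y 1, hcont.comp (Continuous.prodMk_right 1), fun y ↦ ?_, ?_⟩
  · simpa using (hγ y).eqOn h1
  · have hconst : IsLiftOn p (AffineMap.lineMap (p x) (p x)) (Icc (0 : ℝ) 1) fun _ ↦ x :=
      ⟨continuousOn_const, fun t _ ↦ by simp⟩
    exact (hγ (p x)).eqOn_of_isPreconnected hconst (T2Space.isSeparatedMap p)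
      hp.isLocallyInjective isPreconnected_Icc h0 (hγ0 (p x)) h1

theorem bijective_of_lift_segments [T2Space X] [ConnectedSpace X] (hp : IsLocalHomeomorph p)
    (hlift : ∀ x y, ∃ γ, IsLiftOn p (AffineMap.lineMap (p x) y) (Icc (0 : ℝ) 1) γ ∧ γ 0 = x) :
    Function.Bijective p := by
  obtain ⟨x⟩ : Nonempty X := inferInstance
  obtain ⟨σ, hσ, hpσ, hσx⟩ := exists_continuous_rightInverse_of_lift_segments hp (hlift x)
  have hσp : σ ∘ p = id :=
    (T2Space.isSeparatedMap p).eq_of_comp_eq hp.isLocallyInjective (hσ.comp hp.continuous)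
      continuous_id (funext fun y ↦ hpσ (p y)) x hσx
  exact ⟨Function.LeftInverse.injective (congrFun hσp), hpσ.surjective⟩

end Segments

end Lifting

section InverseFunctionTheorem

variable {𝕜 : Type*} [RCLike 𝕜] {E F : Type*} [NormedAddCommGroup E] [NormedSpace 𝕜 E]
  [NormedAddCommGroup F] [NormedSpace 𝕜 F] {n : WithTop ℕ∞}

-- For `n = ∞`, being `C^n` at `a` does not imply being `C^n` on a neighbourhood of `a`.
theorem isLocalDiffeomorphAt_of_isInvertible_fderiv [CompleteSpace E] {f : E → F} {U : Set E}
    (hf : ContDiffOn 𝕜 n f U) (hU : IsOpen U) (hn : n ≠ 0)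
    (hinv : ∀ x ∈ U, (fderiv 𝕜 f x).IsInvertible) {a : E} (ha : a ∈ U) :
    IsLocalDiffeomorphAt 𝓘(𝕜, E) 𝓘(𝕜, F) n f a := by
  have hfat : ∀ x ∈ U, ContDiffAt 𝕜 n f x := fun x hx ↦ hf.contDiffAt (hU.mem_nhds hx)
  have hderiv : ∀ x ∈ U, ∃ L : E ≃L[𝕜] F, HasFDerivAt f (L : E →L[𝕜] F) x := by
    intro x hx
    obtain ⟨L, hL⟩ := hinv x hx
    exact ⟨L, hL ▸ ((hfat x hx).differentiableAt hn).hasFDerivAt⟩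
  obtain ⟨L, hL⟩ := hderiv a ha
  let e := ((hfat a ha).toOpenPartialHomeomorph f hL hn).restrOpen U hU
  have he : ∀ x ∈ e.source, x ∈ U := fun x hx ↦ hx.2
  have hsymm : ContDiffOn 𝕜 n e.symm e.target := by
    intro y hy
    have hyU : e.symm y ∈ U := he _ (e.map_target hy)
    obtain ⟨L', hL'⟩ := hderiv _ hyU
    exact (e.contDiffAt_symm hy hL' (hfat _ hyU)).contDiffWithinAt
  exact ⟨⟨e.toPartialEquiv, e.open_source, e.open_target, (hf.mono he).contMDiffOn,
    hsymm.contMDiffOn⟩, ⟨(hfat a ha).mem_toOpenPartialHomeomorph_source hL hn, ha⟩,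
    fun _ _ ↦ rfl⟩

variable {H : Type*} [TopologicalSpace H] {I : ModelWithCorners 𝕜 E H} {M : Type*}
  [TopologicalSpace M] [ChartedSpace H M]

theorem isLocalDiffeomorph_of_isInvertible_mfderiv [CompleteSpace E] [I.Boundaryless]
    [IsManifold I n M] {p : M → F} (hp : ContMDiff I 𝓘(𝕜, F) n p) (hn : n ≠ 0)
    (hinv : ∀ x, (mfderiv I 𝓘(𝕜, F) p x).IsInvertible) : IsLocalDiffeomorph I 𝓘(𝕜, F) n p := by
  intro x
  have : IsManifold I 1 M := .of_le (ENat.one_le_iff_ne_zero_withTop.2 hn)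
  let φ : PartialDiffeomorph I 𝓘(𝕜, E) M E n :=
    { extChartAt I x with
      open_source := isOpen_extChartAt_source x
      open_target := isOpen_extChartAt_target x
      contMDiffOn_toFun := (extChartAt_source I x).symm ▸ contMDiffOn_extChartAt
      contMDiffOn_invFun := contMDiffOn_extChartAt_symm x }
  have hxφ : x ∈ φ.source := mem_extChartAt_source x
  have hsmooth : ContDiffOn 𝕜 n (p ∘ φ.symm) φ.target :=
    (hp.comp_contMDiffOn φ.symm.contMDiffOn).contDiffOn
  have hderiv : ∀ y ∈ φ.target, (fderiv 𝕜 (p ∘ φ.symm) y).IsInvertible := by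
    intro y hy
    have hφ : (mfderiv 𝓘(𝕜, E) I φ.symm y).IsInvertible := by
      have hwithin := isInvertible_mfderivWithin_extChartAt_symm (I := I) hy
      rwa [I.range_eq_univ, mfderivWithin_univ] at hwithin
    rw [← mfderiv_eq_fderiv, mfderiv_comp y (hp.mdifferentiableAt hn)
      (φ.symm.mdifferentiableAt hn hy)]
    exact (hinv _).comp hφ
  obtain ⟨ψ, hxψ, hψ⟩ := isLocalDiffeomorphAt_of_isInvertible_fderiv hsmooth φ.open_target hn
    hderiv (φ.map_source hxφ)
  refine ⟨φ.trans ψ, ⟨hxφ, hxψ⟩, fun z hz ↦ ?_⟩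
  exact (congrArg p (φ.left_inv hz.1)).symm.trans (hψ hz.2)

end InverseFunctionTheorem

section LocalDiffeomorph

variable {𝕜 : Type*} [NontriviallyNormedField 𝕜]
  {E E' F : Type*} [NormedAddCommGroup E] [NormedSpace 𝕜 E] [NormedAddCommGroup E']
  [NormedSpace 𝕜 E'] [NormedAddCommGroup F] [NormedSpace 𝕜 F]
  {H H' G : Type*} [TopologicalSpace H] [TopologicalSpace H'] [TopologicalSpace G]
  {I : ModelWithCorners 𝕜 E H} {I' : ModelWithCorners 𝕜 E' H'} {J : ModelWithCorners 𝕜 F G}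
  {A M N : Type*} [TopologicalSpace A] [ChartedSpace H' A] [TopologicalSpace M]
  [ChartedSpace H M] [TopologicalSpace N] [ChartedSpace G N] {n : WithTop ℕ∞}

theorem isLocalDiffeomorph_of_le {p : M → N} {m : WithTop ℕ∞} (hp : IsLocalDiffeomorph I J n p)
    (hmn : m ≤ n) : IsLocalDiffeomorph I J m p := by
  intro x
  obtain ⟨φ, hx, hφ⟩ := hp x
  exact ⟨{ φ with
    contMDiffOn_toFun := φ.contMDiffOn_toFun.of_le hmn
    contMDiffOn_invFun := φ.contMDiffOn_invFun.of_le hmn }, hx, hφ⟩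

theorem contMDiffOn_of_isLocalDiffeomorph_comp {p : M → N} {γ : A → M} {s : Set A}
    (hp : IsLocalDiffeomorph I J n p) (hγ : ContinuousOn γ s)
    (h : ContMDiffOn I' J n (p ∘ γ) s) : ContMDiffOn I' I n γ s := by
  intro a ha
  have hpa : IsLocalDiffeomorphAt I J n p (γ a) := hp (γ a)
  refine (hpa.localInverse_contMDiffAt.comp_contMDiffWithinAt a (h a ha)).congr_of_eventuallyEq
    (((hγ a ha).eventually hpa.localInverse_eventuallyEq_left).mono fun t ht ↦ ht.symm) ?_
  exact hpa.localInverse_eventuallyEq_left.self_of_nhds.symm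

end LocalDiffeomorph

section Riemannian

variable {E : Type*} [NormedAddCommGroup E] [NormedSpace ℝ E] {H : Type*} [TopologicalSpace H]
  {I : ModelWithCorners ℝ E H} {M : Type*}

section PreservesMetric

variable [TopologicalSpace M] [ChartedSpace H M]
  [RiemannianBundle (fun x : M ↦ TangentSpace I x)]
  {F : Type*} [NormedAddCommGroup F] [NormedSpace ℝ F] {G : Type*} [TopologicalSpace G]
  {J : ModelWithCorners ℝ F G} {N : Type*} [TopologicalSpace N] [ChartedSpace G N]
  [RiemannianBundle (fun y : N ↦ TangentSpace J y)] {p : M → N}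

variable (I J) in
/-- `p` pulls the Riemannian metric of its codomain back to that of its domain, as an isometric
immersion does; the regularity of `p` is a separate hypothesis wherever it matters. -/
def PreservesMetric (p : M → N) : Prop :=
  ∀ (x : M) (v w : TangentSpace I x),
    inner ℝ (mfderiv I J p x v) (mfderiv I J p x w) = inner ℝ v w

namespace PreservesMetric

theorem norm_mfderiv (hp : PreservesMetric I J p) (x : M) (v : TangentSpace I x) :
    ‖mfderiv I J p x v‖ = ‖v‖ := by
  rw [norm_eq_sqrt_real_inner, norm_eq_sqrt_real_inner, hp]

theorem enorm_mfderiv (hp : PreservesMetric I J p) (x : M) (v : TangentSpace I x) :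
    ‖mfderiv I J p x v‖ₑ = ‖v‖ₑ := by
  rw [← ofReal_norm, ← ofReal_norm, hp.norm_mfderiv]

theorem injective_mfderiv (hp : PreservesMetric I J p) (x : M) :
    Function.Injective (mfderiv I J p x) := by
  refine (injective_iff_map_eq_zero _).2 fun v hv ↦ norm_eq_zero.1 ?_
  rw [← hp.norm_mfderiv, hv, norm_zero]

theorem isInvertible_mfderiv [FiniteDimensional ℝ E] [FiniteDimensional ℝ F]
    (hp : PreservesMetric I J p) (hdim : Module.finrank ℝ E = Module.finrank ℝ F) (x : M) :
    (mfderiv I J p x).IsInvertible := by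
  let L : E →L[ℝ] F := mfderiv I J p x
  exact ⟨(LinearEquiv.ofInjectiveOfFinrankEq L.toLinearMap
    (hp.injective_mfderiv x) hdim).toContinuousLinearEquiv, by ext; rfl⟩

theorem pathELength_comp (hp : PreservesMetric I J p) (hpd : MDifferentiable I J p) {γ : ℝ → M}
    {a b : ℝ} (hγ : ∀ t ∈ Ioo a b, MDifferentiableAt 𝓘(ℝ, ℝ) I γ t) :
    pathELength J (p ∘ γ) a b = pathELength I γ a b := by
  rw [pathELength_eq_lintegral_mfderiv_Ioo, pathELength_eq_lintegral_mfderiv_Ioo]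
  refine setLIntegral_congr_fun measurableSet_Ioo fun t ht ↦ ?_
  rw [mfderiv_comp t (hpd (γ t)) (hγ t ht)]
  exact hp.enorm_mfderiv _ _

end PreservesMetric

end PreservesMetric

section Lifts

variable [PseudoEMetricSpace M] [ChartedSpace H M]
  [RiemannianBundle (fun x : M ↦ TangentSpace I x)] [IsRiemannianManifold I M]

theorem IsLiftOn.edist_le_pathELength
    {F : Type*} [NormedAddCommGroup F] [NormedSpace ℝ F] {G : Type*} [TopologicalSpace G]
    {J : ModelWithCorners ℝ F G} {N : Type*} [TopologicalSpace N] [ChartedSpace G N]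
    [RiemannianBundle (fun y : N ↦ TangentSpace J y)] {p : M → N}
    {c : ℝ → N} {γ : ℝ → M} {a b : ℝ} (hγ : IsLiftOn p c (Icc a b) γ)
    (hp : PreservesMetric I J p) (hloc : IsLocalDiffeomorph I J 1 p)
    (hc : ContMDiffOn 𝓘(ℝ, ℝ) J 1 c (Icc a b)) (hab : a ≤ b) :
    edist (γ a) (γ b) ≤ pathELength J c a b := by
  have hsmooth : ContMDiffOn 𝓘(ℝ, ℝ) I 1 γ (Icc a b) :=
    contMDiffOn_of_isLocalDiffeomorph_comp hloc hγ.continuousOn (hc.congr hγ.eqOn)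
  have hdiff : ∀ t ∈ Ioo a b, MDifferentiableAt 𝓘(ℝ, ℝ) I γ t := fun t ht ↦
    (hsmooth.contMDiffAt (Icc_mem_nhds ht.1 ht.2)).mdifferentiableAt one_ne_zero
  calc edist (γ a) (γ b) = riemannianEDist I (γ a) (γ b) := IsRiemannianManifold.out _ _
    _ ≤ pathELength I γ a b := riemannianEDist_le_pathELength hsmooth rfl rfl hab
    _ = pathELength J (p ∘ γ) a b :=
      (hp.pathELength_comp (hloc.mdifferentiable one_ne_zero) hdiff).symm
    _ = pathELength J c a b := pathELength_congr hγ.eqOn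

variable {F : Type*} [NormedAddCommGroup F] [InnerProductSpace ℝ F] {p : M → F} {c : ℝ → F}
  {γ : ℝ → M} {K : ℝ≥0}

theorem pathELength_le_of_lipschitzWith (hc : LipschitzWith K c) (a b : ℝ) :
    pathELength 𝓘(ℝ, F) c a b ≤ K * edist a b := by
  have hbound : ∀ t, ‖mfderiv 𝓘(ℝ, ℝ) 𝓘(ℝ, F) c t 1‖ₑ ≤ K := by
    intro t
    have hderiv : ‖deriv c t‖ₑ ≤ K := enorm_le_coe.2 (norm_deriv_le_of_lipschitz hc)
    rwa [enorm_tangentSpace_vectorSpace, mfderiv_eq_fderiv]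
  rw [pathELength_eq_lintegral_mfderiv_Icc]
  calc ∫⁻ t in Icc a b, ‖mfderiv 𝓘(ℝ, ℝ) 𝓘(ℝ, F) c t 1‖ₑ
      ≤ ∫⁻ _ in Icc a b, (K : ℝ≥0∞) := lintegral_mono hbound
    _ = K * ENNReal.ofReal (b - a) := by rw [setLIntegral_const, Real.volume_Icc]
    _ ≤ K * edist a b := by
      rw [edist_comm, edist_dist, Real.dist_eq]
      gcongr
      exact le_abs_self _

theorem IsLiftOn.lipschitzOnWith {s : Set ℝ} (hγ : IsLiftOn p c s γ)
    (hp : PreservesMetric I 𝓘(ℝ, F) p) (hloc : IsLocalDiffeomorph I 𝓘(ℝ, F) 1 p)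
    (hs : s.OrdConnected) (hc : ContDiff ℝ 1 c) (hcK : LipschitzWith K c) :
    LipschitzOnWith K γ s := by
  have hle : ∀ a ∈ s, ∀ b ∈ s, a ≤ b → edist (γ a) (γ b) ≤ K * edist a b := fun a ha b hb hab ↦
    ((hγ.mono (hs.out ha hb)).edist_le_pathELength hp hloc hc.contMDiff.contMDiffOn hab).trans
      (pathELength_le_of_lipschitzWith hcK a b)
  intro a ha b hb
  rcases le_total a b with hab | hba
  · exact hle a ha b hb hab
  · rw [edist_comm, edist_comm a]
    exact hle b hb a ha hba

theorem IsLiftOn.exists_tendsto [CompleteSpace M] {a b : ℝ} (hγ : IsLiftOn p c (Ico a b) γ)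
    (hp : PreservesMetric I 𝓘(ℝ, F) p) (hloc : IsLocalDiffeomorph I 𝓘(ℝ, F) 1 p)
    (hc : ContDiff ℝ 1 c) (hcK : LipschitzWith K c) (hab : a < b) :
    ∃ x, Tendsto γ (𝓝[<] b) (𝓝 x) := by
  have hunif : UniformContinuousOn γ (Ico a b) :=
    (hγ.lipschitzOnWith hp hloc ordConnected_Ico hc hcK).uniformContinuousOn
  have hcauchy : Cauchy (𝓝[<] b) := cauchy_nhds.mono nhdsWithin_le_nhds
  exact CompleteSpace.complete <|
    hcauchy.map_of_le hunif (le_principal_iff.2 (Ico_mem_nhdsLT hab))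

end Lifts

variable [EMetricSpace M] [ChartedSpace H M]
  [RiemannianBundle (fun x : M ↦ TangentSpace I x)] [IsRiemannianManifold I M] [CompleteSpace M]
  {F : Type*} [NormedAddCommGroup F] [InnerProductSpace ℝ F] {p : M → F}

theorem PreservesMetric.exists_isLiftOn_lineMap (hp : PreservesMetric I 𝓘(ℝ, F) p)
    (hloc : IsLocalDiffeomorph I 𝓘(ℝ, F) 1 p) (x : M) (y : F) :
    ∃ γ, IsLiftOn p (AffineMap.lineMap (p x) y) (Icc (0 : ℝ) 1) γ ∧ γ 0 = x := by
  refine exists_isLiftOn_Icc_of_tendsto hloc.isLocalHomeomorph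
    AffineMap.lineMap_continuous zero_le_one (AffineMap.lineMap_apply_zero _ _).symm
    fun t ht γ hγ ↦ hγ.exists_tendsto hp hloc ?_ (lipschitzWith_lineMap (p x) y) ht
  exact (ContinuousAffineMap.lineMap (R := ℝ) (p x) y).contDiff

theorem PreservesMetric.exists_diffeomorph_eq [ConnectedSpace M] {n : WithTop ℕ∞}
    (hp : PreservesMetric I 𝓘(ℝ, F) p) (hloc : IsLocalDiffeomorph I 𝓘(ℝ, F) n p) (hn : 1 ≤ n) :
    ∃ Φ : M ≃ₘ^n⟮I, 𝓘(ℝ, F)⟯ F, ⇑Φ = p := by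
  have hbij : Function.Bijective p := bijective_of_lift_segments hloc.isLocalHomeomorph
    (hp.exists_isLiftOn_lineMap (isLocalDiffeomorph_of_le hloc hn))
  exact ⟨hloc.diffeomorphOfBijective hbij, rfl⟩

end Riemannian

end LocalIsometry

namespace SingularSemiEuclidean

open LocalIsometry

attribute [local instance 2000] chartedSpaceSelf

/-- The projection `(x, y, z) ↦ (x, y)`, which carries `dx² + dy²` to the Euclidean metric. -/
noncomputable def planeProjection : R021 →L[ℝ] EuclideanSpace ℝ (Fin 2) :=
  (EuclideanSpace.equiv (Fin 2) ℝ).symm.toContinuousLinearMap ∘L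
    ContinuousLinearMap.pi fun i ↦ EuclideanSpace.proj i.castSucc

theorem planeProjection_apply (q : R021) (i : Fin 2) : planeProjection q i = q i.castSucc := rfl

theorem inner_planeProjection (q v w : R021) :
    inner ℝ (planeProjection v) (planeProjection w) = degenerateMetric q v w := by
  simp [planeProjection_apply, degenerateMetric, PiLp.inner_apply, mul_comm]

theorem mem_entireGraph_iff {F : EuclideanSpace ℝ (Fin 2) → ℝ} {q : R021} :
    q ∈ entireGraph F ↔ q 2 = F (planeProjection q) := by
  have hproj : planeProjection q = !₂[q 0, q 1] := by
    ext i
    fin_cases i <;> rfl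
  constructor
  · rintro ⟨u, v, rfl⟩
    rw [hproj]
    rfl
  · intro h
    refine ⟨q 0, q 1, ?_⟩
    rw [← hproj, ← h]
    ext i
    fin_cases i <;> rfl

theorem range_eq_entireGraph {X : Type*} (f : X → R021) (e : X ≃ EuclideanSpace ℝ (Fin 2))
    (he : ⇑e = planeProjection ∘ f) : Set.range f = entireGraph fun q ↦ f (e.symm q) 2 := by
  ext q
  rw [mem_entireGraph_iff]
  constructor
  · rintro ⟨x, rfl⟩
    rw [← Function.comp_apply (f := planeProjection), ← he, e.symm_apply_apply]
  · intro hq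
    have hproj : planeProjection (f (e.symm (planeProjection q))) = planeProjection q := by
      rw [← Function.comp_apply (f := planeProjection), ← he, e.apply_symm_apply]
    refine ⟨e.symm (planeProjection q), ?_⟩
    ext i
    refine Fin.lastCases hq.symm (fun j ↦ ?_) i
    exact congrArg (· j) hproj

namespace IsIsometricImmersion

variable {M : Type*} [TopologicalSpace M] [ChartedSpace (EuclideanSpace ℝ (Fin 2)) M]
  [RiemannianBundle (fun x : M ↦ TangentSpace (𝓡 2) x)] {f : M → R021}

theorem contMDiff_planeProjection_comp (hf : IsIsometricImmersion f) :
    ContMDiff (𝓡 2) (𝓡 2) ∞ (planeProjection ∘ f) :=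
  planeProjection.contMDiff.comp hf.contMDiff

theorem preservesMetric_planeProjection_comp (hf : IsIsometricImmersion f) :
    PreservesMetric (𝓡 2) (𝓡 2) (planeProjection ∘ f) := by
  intro x v w
  have hderiv : mfderiv (𝓡 2) (𝓡 2) (planeProjection ∘ f) x =
      planeProjection ∘L mfderiv (𝓡 2) (𝓡 3) f x := by
    rw [mfderiv_comp x planeProjection.mdifferentiableAt
      (hf.contMDiff.mdifferentiableAt (by simp)), planeProjection.mfderiv_eq]
    rfl
  rw [hderiv, ← hf.pullback_eq x v w]
  exact inner_planeProjection (f x) _ _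

end IsIsometricImmersion

theorem IsIsometricImmersion.exists_diffeomorph_eq_planeProjection_comp {M : Type*} [EMetricSpace M]
    [ChartedSpace (EuclideanSpace ℝ (Fin 2)) M] [IsManifold (𝓡 2) ∞ M]
    [RiemannianBundle (fun x : M ↦ TangentSpace (𝓡 2) x)] [IsRiemannianManifold (𝓡 2) M]
    [ConnectedSpace M] [CompleteSpace M] {f : M → R021} (hf : IsIsometricImmersion f) :
    ∃ Φ : M ≃ₘ^∞⟮𝓡 2, 𝓡 2⟯ EuclideanSpace ℝ (Fin 2), ⇑Φ = planeProjection ∘ f := by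
  have hmetric := hf.preservesMetric_planeProjection_comp
  have hloc : IsLocalDiffeomorph (𝓡 2) (𝓡 2) ∞ (planeProjection ∘ f) :=
    isLocalDiffeomorph_of_isInvertible_mfderiv hf.contMDiff_planeProjection_comp (by simp)
      (hmetric.isInvertible_mfderiv rfl)
  exact hmetric.exists_diffeomorph_eq hloc (by simp)

end SingularSemiEuclidean

theorem theorem4p3p1 {M : Type*} [EMetricSpace M] [ChartedSpace (EuclideanSpace ℝ (Fin 2)) M]
    [IsManifold (𝓡 2) ∞ M] [RiemannianBundle (fun x : M ↦ TangentSpace (𝓡 2) x)]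
    [IsContMDiffRiemannianBundle (𝓡 2) ∞ (EuclideanSpace ℝ (Fin 2))
      (fun x : M ↦ TangentSpace (𝓡 2) x)]
    [IsRiemannianManifold (𝓡 2) M] [ConnectedSpace M] [CompleteSpace M]
    (f : M → SingularSemiEuclidean.R021) (hf : SingularSemiEuclidean.IsIsometricImmersion f) :
    SingularSemiEuclidean.IsIsometricToEuclideanPlane M ∧
      ∃ F : EuclideanSpace ℝ (Fin 2) → ℝ,
        ContDiff ℝ ∞ F ∧ Set.range f = SingularSemiEuclidean.entireGraph F := by
  obtain ⟨Φ, hΦ⟩ := hf.exists_diffeomorph_eq_planeProjection_comp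
  refine ⟨⟨Φ, hΦ ▸ hf.preservesMetric_planeProjection_comp⟩, fun q ↦ f (Φ.symm q) 2, ?_,
    SingularSemiEuclidean.range_eq_entireGraph f Φ.toEquiv hΦ⟩
  have hsmooth : ContDiff ℝ ∞ (f ∘ Φ.symm) := (hf.contMDiff.comp Φ.symm.contMDiff).contDiff
  exact (EuclideanSpace.proj (𝕜 := ℝ) 2).contDiff.comp hsmooth
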